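/- **Setting.** Let $(E,\mathcal E,\mu)$ be a measure space with $\mu$ $\sigma$-finite, and let $\mathscr P = L_\infty(E,\mu)\cap L_1(E,\mu)$ (real-valued functions up to $\mu$-a.e. equality). Let $n\ge 2$ and let $X_1,\dots,X_n$ be independent random elements of $E$ whose laws $P_i^\star$ have densities $p_i^\star\in\mathscr P$ with respect to $\mu$; put $p^\star=\frac1n\sum_{i=1}^n p_i^\star$. Let $\mathcal C\subset\mathcal E$ be a class of sets of finite VC-dimension $V$ (the largest cardinality of a finite set shattered by $\mathcal C$). Assume that $\mathcal C$ is pointwise measurable: there is a countable $\mathcal D\subset\mathcal C$ such that the indicator of every $A\in\mathcal C$ is the pointwise limit of the indicators of a sequence in $\mathcal D$. For $h>0$ and $f\in\mathscr P$ let $$|f|_h=\sup_{A\in\mathcal C}\frac{1}{\mu(A)+h}\Big|\int_A f\,d\mu\Big| ,$$ with $1/\infty=0$, and let $\|\cdot\|_\infty$ be the essential supremum norm. Let $$\Gamma=\log\lceil\log_2 n\rceil+\log\Big(2\sum_{j=0}^{V\wedge n}\binom nj\Big).$$ For $m\subset\mathscr P$, $h>0$ and $C_h:\mathscr P^2\to\mathcal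 C$ define $\varepsilon_m(h,C_h)$ and $\kappa_m(h)$ by $$1-\varepsilon_m(h,C_h)=\inf_{p,q\in m,\ |p-q|_h\ne0}\frac{\big|\int_{C_h(p,q)}(p-q)\,d\mu\big|}{(\mu(C_h(p,q))+h)\,|p-q|_h},\qquad \kappa_m(h)=\inf_{p,q\in m,\ p\neq q}\frac{|p-q|_h}{\|p-q\|_\infty},$$ where the infima are taken in $[0,1]$ (so $\inf\emptyset=1$). Let $\tau_h(p,q)\in\{-1,1\}$ be a sign of $\int_{C_h(p,q)}(p-q)\,d\mu$ (either value if the integral is $0$), and let $$T(\mathbf X,p,q)=\frac1n\sum_{i=1}^n\tau_h(p,q)\,\frac{\int_{C_h(p,q)}p\,d\mu-\mathbf 1_{C_h(p,q)}(X_i)}{\mu(C_h(p,q))+h},\qquad T_m(\mathbf X,p)=\sup_{q\in m}T(\mathbf X,p,q).$$ For $\delta>0$, a hun-estimator on $m$ (with parameters $h,C_h,\tau_h,\delta$) is any random element $\hat p\in m$ with $T_m(\mathbf X,\hat p)\le\inf_{p\in m}T_m(\mathbf X,p)+\delta$. **Theorem.** For every $x>0$ there is an event of probability at least $1-2e^{-x}$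 on which the following holds for all countable $m\subset\mathscr P$, all $h>0$, all $C_h:\mathscr P^2\to\mathcal C$ (and signs $\tau_h$), all $\delta>0$ and all corresponding hun-estimators $\hat p$, writing $\varepsilon=\varepsilon_m(h,C_h)$. For all $\bar p\in m$, $$(1-\varepsilon)\,|\bar p-\hat p|_h\le 2|p^\star-\bar p|_h+\delta+\max\Big(58\sqrt{\tfrac{|p^\star|_h(\Gamma+x)}{hn}},\ 40\,\tfrac{\Gamma+x}{hn}\Big),$$ and moreover $$(1-\varepsilon)\kappa_m(h)\,\|\hat p-p^\star\|_\infty\le\big[2+(1-\varepsilon)\kappa_m(h)\big]\inf_{p\in m}\|p-p^\star\|_\infty+\delta+\max\Big(58\sqrt{\tfrac{|p^\star|_h(\Gamma+x)}{hn}},\ 40\,\tfrac{\Gamma+x}{hn}\Big).$$ -/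

import Mathlib

open MeasureTheory ProbabilityTheory Filter

noncomputable section

namespace Hun

variable {E : Type*} [MeasurableSpace E]

/-- The class `𝒞` shatters the finite set `S`: every subset of `S` is a trace `S ∩ A`, `A ∈ 𝒞`. -/
def Shatters (𝒞 : Set (Set E)) (S : Finset E) : Prop :=
  ∀ T : Set E, T ⊆ (S : Set E) → ∃ A ∈ 𝒞, (S : Set E) ∩ A = T

/-- The VC-dimension: the largest cardinality of a finite shattered set (`⊤` if unbounded). -/
def vcDim (𝒞 : Set (Set E)) : ℕ∞ :=
  ⨆ (S : Finset E) (_ : Shatters 𝒞 S), (S.card : ℕ∞)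

/-- Pointwise measurability of a class of sets: there is a countable subclass such that every
member of the class is the pointwise limit (in the sense of indicator functions) of a sequence
of members of the subclass. -/
def PointwiseMeasurable (𝒞 : Set (Set E)) : Prop :=
  ∃ 𝒟 : Set (Set E), 𝒟 ⊆ 𝒞 ∧ 𝒟.Countable ∧
    ∀ A ∈ 𝒞, ∃ D : ℕ → Set E, (∀ k, D k ∈ 𝒟) ∧ ∀ y, ∀ᶠ k in atTop, (y ∈ D k ↔ y ∈ A)

/-- The space `L_∞(E, μ) ∩ L_1(E, μ)` of (equivalence classes of) functions. -/
abbrev Space (μ : Measure E) : Type _ :=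
  ↥(Lp.LpSubmodule ℝ ℝ 1 μ ⊓ Lp.LpSubmodule ℝ ℝ ⊤ μ)

/-- A representative of a class `f`. -/
abbrev Space.fn {μ : Measure E} (f : Space μ) : E → ℝ := ((f : E →ₘ[μ] ℝ) : E → ℝ)

/-- The essential supremum norm. -/
def supNorm {μ : Measure E} (f : Space μ) : ℝ := (eLpNorm f.fn ⊤ μ).toReal

/-- The signed measure of density `f`, i.e. `F(A) = ∫_A f dμ`. -/
def mass {μ : Measure E} (f : Space μ) (A : Set E) : ℝ := ∫ y in A, f.fn y ∂μ

/-- The weight `1 / (μ(A) + h)`, equal to `0` if `μ(A) = ∞`. -/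
def weight (μ : Measure E) (h : ℝ) (A : Set E) : ℝ := ((μ A + ENNReal.ofReal h)⁻¹).toReal

/-- The semi-norm `|f|_h = sup_{A ∈ 𝒞} |∫_A f dμ| / (μ(A) + h)`. For `h > 0` the supremum is over
numbers bounded by `‖f‖_1 / h`. -/
def hNorm {μ : Measure E} (𝒞 : Set (Set E)) (h : ℝ) (f : Space μ) : ℝ :=
  ⨆ A : 𝒞, weight μ h A * |mass f A|

/-- The infimum, taken inside `[0, 1]`, of a set of numbers of `[0, 1]`; in particular
the infimum of the empty set is `1`. -/
def unitInf (S : Set ℝ) : ℝ := sInf (insert 1 S)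

/-- `ε_m(h, C_h)`: `1 - ε_m(h, C_h)` is the infimum over the pairs `p, q ∈ m` of
`|∫_{C_h(p,q)} (p - q) dμ| / ((μ(C_h(p,q)) + h) |p - q|_h)`, where the meaningless quotients
`0 / 0` are left out. -/
def eps {μ : Measure E} (𝒞 : Set (Set E)) (m : Set (Space μ)) (h : ℝ)
    (C : Space μ → Space μ → 𝒞) : ℝ :=
  1 - unitInf {r | ∃ p ∈ m, ∃ q ∈ m, hNorm 𝒞 h (p - q) ≠ 0 ∧
    r = weight μ h (C p q) * |mass (p - q) (C p q)| / hNorm 𝒞 h (p - q)}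

/-- `κ_m(h)`: the infimum of `|p - q|_h / ‖p - q‖_∞` over the pairs `p ≠ q` in `m`. -/
def kappa {μ : Measure E} (𝒞 : Set (Set E)) (m : Set (Space μ)) (h : ℝ) : ℝ :=
  unitInf {r | ∃ p ∈ m, ∃ q ∈ m, p ≠ q ∧ r = hNorm 𝒞 h (p - q) / supNorm (p - q)}

/-- `τ(p, q) ∈ {-1, 1}` is a sign of `∫_{C(p,q)} (p - q) dμ` (either value if that integral
vanishes). -/
def IsSign {μ : Measure E} {𝒞 : Set (Set E)} (C : Space μ → Space μ → 𝒞)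
    (τ : Space μ → Space μ → ℝ) : Prop :=
  ∀ p q, (τ p q = 1 ∨ τ p q = -1) ∧ τ p q * mass (p - q) (C p q) = |mass (p - q) (C p q)|

/-- The function `t_{p,q}(y) = τ(p,q) (P(C(p,q)) - 1_{C(p,q)}(y)) / (μ(C(p,q)) + h)`. -/
def tFun {μ : Measure E} {𝒞 : Set (Set E)} (h : ℝ) (C : Space μ → Space μ → 𝒞)
    (τ : Space μ → Space μ → ℝ) (p q : Space μ) (y : E) : ℝ :=
  τ p q * weight μ h (C p q) *
    (mass p (C p q) - Set.indicator (C p q : Set E) (fun _ => (1 : ℝ)) y)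

/-- The T-test `T(s, p, q) = (1/n) ∑_i t_{p,q}(s_i)` on the sample `s`. -/
def tTest {μ : Measure E} {𝒞 : Set (Set E)} {n : ℕ} (h : ℝ) (C : Space μ → Space μ → 𝒞)
    (τ : Space μ → Space μ → ℝ) (s : Fin n → E) (p q : Space μ) : ℝ :=
  (1 / (n : ℝ)) * ∑ i, tFun h C τ p q (s i)

/-- `T_m(s, p) = sup_{q ∈ m} T(s, p, q)`. For `h > 0` the supremum is over numbers bounded
by `(‖p‖_1 + 1) / h`. -/
def tSup {μ : Measure E} {𝒞 : Set (Set E)} {n : ℕ} (m : Set (Space μ)) (h : ℝ)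
    (C : Space μ → Space μ → 𝒞) (τ : Space μ → Space μ → ℝ) (s : Fin n → E)
    (p : Space μ) : ℝ :=
  ⨆ q : m, tTest h C τ s p q

/-- `phat` is an `h`-approximate uniform-norm estimator on the model `m` based on the observations
`X`, with tolerance `δ`: `phat ∈ m` and `T_m(X, phat) ≤ inf_{p ∈ m} T_m(X, p) + δ`.
Every choice of such a map is allowed, measurable or not. -/
def IsHunEstimator {μ : Measure E} {𝒞 : Set (Set E)} {Ω : Type*} {n : ℕ} (X : Fin n → Ω → E)
    (m : Set (Space μ)) (h : ℝ) (C : Space μ → Space μ → 𝒞) (τ : Space μ → Space μ → ℝ) (δ : ℝ)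
    (phat : Ω → Space μ) : Prop :=
  ∀ ω, phat ω ∈ m ∧
    ∀ p ∈ m, tSup m h C τ (fun i => X i ω) (phat ω) ≤ tSup m h C τ (fun i => X i ω) p + δ

/-- `p` is the probability density of `Y` with respect to `μ`. -/
def IsDensity {μ : Measure E} {Ω : Type*} [MeasurableSpace Ω] (P : Measure Ω) (Y : Ω → E)
    (p : Space μ) : Prop :=
  0 ≤ᵐ[μ] p.fn ∧ P.map Y = μ.withDensity (fun y => ENNReal.ofReal (p.fn y))

/-- The density `p* = (1/n) ∑_i p_i*` of the mixture. -/
def mixture {μ : Measure E} {n : ℕ} (p : Fin n → Space μ) : Space μ := (1 / (n : ℝ)) • ∑ i, p i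

/-- `Γ = log ⌈log₂ n⌉ + log (2 ∑_{j = 0}^{V ∧ n} (n choose j))`. -/
def Gam (n V : ℕ) : ℝ :=
  Real.log (⌈Real.logb 2 n⌉ : ℝ) +
    Real.log (2 * ∑ j ∈ Finset.range (min V n + 1), (n.choose j : ℝ))

/-- The remainder term `max (58 √(|p*|_h (Γ + x) / (h n)), 40 (Γ + x) / (h n))`. -/
def remainder {μ : Measure E} (𝒞 : Set (Set E)) (n V : ℕ) (x h : ℝ) (pstar : Space μ) : ℝ :=
  max (58 * √(hNorm 𝒞 h pstar * (Gam n V + x) / (h * n))) (40 * ((Gam n V + x) / (h * n)))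

end Hun

end

/-! The theorem separates into one probabilistic event, depending only on the class and the sample,
and deterministic consequences valid for all models, `h`, selections and estimators at once.

Probabilistic half: `n P_n(A)` stays within `6 √(G M(A)) + 8 G` of its mean `M(A)` uniformly over
the class, with `G = Γ + x`. This comes from Laplace transforms of `c M(A) + d (n P_n(A))`. Jensen
replaces `M(A)` by the count of a ghost sample, and averaging over exchanges of each observation
with its ghost makes the transform factorise. Each factor is at most 1 on average as soon as `e^c +
e^d ≤ 2`, so only the number of pairs of traces remains; Sauer's lemma bounds it by the square of
the binomial sum. Taking `c ≈ ±u`, `d = ∓u` and a union bound over a dyadic grid of `u`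
(`measure_exists_deviation_le`) yields the bound of Bernstein type; pointwise limits carry it to the
whole class.

Deterministic half: after weighting by `1 / (μ(A) + h)`, the square root is governed by `|p*|_h`.
The definition of `1 - ε` reduces `|pbar - phat|_h` to the single set `C(phat, pbar)`, where the
T-test compares the two candidates (`one_sub_eps_mul_hNorm_le_of_deviation`). The uniform norm
follows from `κ` and `|·|_h ≤ ‖·‖_∞`. -/

namespace Hun

/-! ### Traces on a sample and Sauer's lemma -/

open Classical in
/-- The indices `i` of the sample `s` with `s i ∈ A`. -/
noncomputable def trace {E : Type*} {n : ℕ} (s : Fin n → E) (A : Set E) : Finset (Fin n) :=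
  Finset.univ.filter fun i => s i ∈ A

theorem mem_trace {E : Type*} {n : ℕ} {s : Fin n → E} {A : Set E} {i : Fin n} :
    i ∈ trace s A ↔ s i ∈ A := by
  simp [trace]

/-- The traces of the class `𝒞` on the sample `s`. -/
noncomputable def traces {E : Type*} {n : ℕ} (𝒞 : Set (Set E)) (s : Fin n → E) :
    Finset (Finset (Fin n)) :=
  (Set.toFinite (trace s '' 𝒞)).toFinset

theorem mem_traces {E : Type*} {n : ℕ} {𝒞 : Set (Set E)} {s : Fin n → E} {T : Finset (Fin n)} :
    T ∈ traces 𝒞 s ↔ ∃ A ∈ 𝒞, trace s A = T := by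
  simp [traces]

theorem card_le_of_shatters {E : Type*} [MeasurableSpace E] {𝒞 : Set (Set E)} {V : ℕ}
    (hV : vcDim 𝒞 = (V : ℕ∞)) {S : Finset E} (hS : Shatters 𝒞 S) : S.card ≤ V := by
  have : (S.card : ℕ∞) ≤ vcDim 𝒞 := le_iSup₂_of_le S hS le_rfl
  rw [hV] at this
  exact_mod_cast this

/-- Two tied observations cannot be separated by a set, so `s` is injective on a shattered set of
indices, and its image is a set of the same size shattered by `𝒞`. -/
theorem card_le_of_traces_shatters {E : Type*} [MeasurableSpace E] {n V : ℕ} {𝒞 : Set (Set E)}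
    (hV : vcDim 𝒞 = (V : ℕ∞)) {s : Fin n → E} {S : Finset (Fin n)}
    (hS : (traces 𝒞 s).Shatters S) : S.card ≤ V := by
  classical
  have key : ∀ T ⊆ S, ∃ A ∈ 𝒞, ∀ i ∈ S, s i ∈ A ↔ i ∈ T := by
    intro T hT
    obtain ⟨u, hu, hST⟩ := hS hT
    obtain ⟨A, hA, rfl⟩ := mem_traces.1 hu
    refine ⟨A, hA, fun i hi => ?_⟩
    rw [← hST, Finset.mem_inter, mem_trace]
    exact ⟨fun h => ⟨hi, h⟩, fun h => h.2⟩
  have hinj : Set.InjOn s S := by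
    intro i hi j hj hij
    obtain ⟨A, -, hA⟩ := key {i} (by simpa using hi)
    have h1 : s i ∈ A := (hA i hi).2 (by simp)
    have h2 := (hA j hj).1 (hij ▸ h1)
    exact (Finset.mem_singleton.1 h2).symm
  rw [← Finset.card_image_of_injOn hinj]
  refine card_le_of_shatters hV fun T hT => ?_
  obtain ⟨A, hA, h⟩ := key (S.filter fun i => s i ∈ T) (Finset.filter_subset _ _)
  refine ⟨A, hA, ?_⟩
  ext y
  constructor
  · rintro ⟨hy, hyA⟩
    obtain ⟨i, hi, rfl⟩ := Finset.mem_image.1 (Finset.mem_coe.1 hy)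
    exact (Finset.mem_filter.1 ((h i hi).1 hyA)).2
  · intro hy
    have hy' := hT hy
    obtain ⟨i, hi, rfl⟩ := Finset.mem_image.1 (Finset.mem_coe.1 hy')
    exact ⟨hy', (h i hi).2 (Finset.mem_filter.2 ⟨hi, hy⟩)⟩

/-- Sauer's lemma for the traces on a sample, possibly with ties. -/
theorem card_traces_le {E : Type*} [MeasurableSpace E] {n V : ℕ} {𝒞 : Set (Set E)}
    (hV : vcDim 𝒞 = (V : ℕ∞)) (s : Fin n → E) :
    (traces 𝒞 s).card ≤ ∑ j ∈ Finset.range (min V n + 1), n.choose j := by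
  classical
  refine (Finset.card_le_card_shatterer _).trans ?_
  have hsub : (traces 𝒞 s).shatterer ⊆ (Finset.range (min V n + 1)).biUnion
      fun j => Finset.powersetCard j (Finset.univ : Finset (Fin n)) := by
    intro S hS
    rw [Finset.mem_shatterer] at hS
    have h1 := card_le_of_traces_shatters hV hS
    have h2 : S.card ≤ n := by simpa using Finset.card_le_univ S
    simp only [Finset.mem_biUnion, Finset.mem_range, Finset.mem_powersetCard]
    exact ⟨S.card, by omega, Finset.subset_univ _, rfl⟩
  refine (Finset.card_le_card hsub).trans (Finset.card_biUnion_le.trans ?_)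
  simp

/-! ### Exponential moments by symmetrization with a ghost sample -/

/-- The number of indices `i` with `s i ∈ A`, as a real number. -/
noncomputable def count {E : Type*} {n : ℕ} (s : Fin n → E) (A : Set E) : ℝ :=
  ∑ i, A.indicator (fun _ => (1 : ℝ)) (s i)

theorem count_nonneg {E : Type*} {n : ℕ} (s : Fin n → E) (A : Set E) : 0 ≤ count s A :=
  Finset.sum_nonneg fun _ _ => Set.indicator_nonneg (fun _ _ => zero_le_one) _

theorem count_le {E : Type*} {n : ℕ} (s : Fin n → E) (A : Set E) : count s A ≤ n := by
  calc count s A ≤ ∑ _i : Fin n, (1 : ℝ) :=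
        Finset.sum_le_sum fun i _ => Set.indicator_le_self' (fun _ _ => zero_le_one) _
    _ = n := by simp

section Measures

variable {E : Type*} [MeasurableSpace E] {n : ℕ}

theorem measurable_count {A : Set E} (hA : MeasurableSet A) :
    Measurable fun s : Fin n → E => count s A :=
  Finset.measurable_sum _ fun i _ =>
    (measurable_const.indicator hA).comp (measurable_pi_apply i)

/-- The expected number of indices `i` with `s i ∈ A`, for a sample of independent elements
with the laws `ν i`. -/
noncomputable def meanCount (ν : Fin n → Measure E) (A : Set E) : ℝ := ∑ i, (ν i).real A

variable (ν : Fin n → Measure E) [∀ i, IsProbabilityMeasure (ν i)]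

theorem integrable_count {A : Set E} (hA : MeasurableSet A) :
    Integrable (fun s => count s A) (Measure.pi ν) :=
  Integrable.of_bound (measurable_count hA).aestronglyMeasurable n
    (ae_of_all _ fun s => by
      rw [Real.norm_of_nonneg (count_nonneg s A)]; exact count_le s A)

theorem integral_count {A : Set E} (hA : MeasurableSet A) :
    ∫ s, count s A ∂(Measure.pi ν) = meanCount ν A := by
  have hm : ∀ i : Fin n, Measurable fun s : Fin n → E =>
      A.indicator (fun _ => (1 : ℝ)) (s i) := fun i =>
    (measurable_const.indicator hA).comp (measurable_pi_apply i)
  unfold count meanCount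
  rw [integral_finsetSum]
  · refine Finset.sum_congr rfl fun i _ => ?_
    have h := (measurePreserving_eval ν i).map_eq
    have h2 := integral_map (μ := Measure.pi ν) (φ := Function.eval i)
      (f := A.indicator (fun _ => (1 : ℝ))) (measurable_pi_apply i).aemeasurable
      (measurable_const.indicator hA).aestronglyMeasurable
    rw [h, integral_indicator_const _ hA] at h2
    simpa using h2.symm
  · intro i _
    refine Integrable.of_bound (hm i).aestronglyMeasurable 1 (ae_of_all _ fun s => ?_)
    exact (norm_indicator_le_norm_self _ _).trans (by simp)

/-- Jensen's inequality for the exponential of a count. -/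
theorem exp_meanCount_le {A : Set E} (hA : MeasurableSet A) (c d : ℝ) :
    ENNReal.ofReal (Real.exp (c * meanCount ν A + d))
      ≤ ∫⁻ s, ENNReal.ofReal (Real.exp (c * count s A + d)) ∂(Measure.pi ν) := by
  have hint : Integrable (fun s => c * count s A + d) (Measure.pi ν) :=
    ((integrable_count ν hA).const_mul c).add (integrable_const d)
  have hexp : Integrable (Real.exp ∘ fun s => c * count s A + d) (Measure.pi ν) := by
    refine Integrable.of_bound (Real.measurable_exp.comp
      (((measurable_count hA).const_mul c).add_const d)).aestronglyMeasurable
      (Real.exp (|c| * n + d)) (ae_of_all _ fun s => ?_)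
    rw [Function.comp, Real.norm_of_nonneg (Real.exp_pos _).le, Real.exp_le_exp]
    have h1 : c * count s A ≤ |c| * count s A :=
      mul_le_mul_of_nonneg_right (le_abs_self c) (count_nonneg s A)
    have h2 := mul_le_mul_of_nonneg_left (count_le s A) (abs_nonneg c)
    linarith
  have h := convexOn_exp.map_integral_le Real.continuous_exp.continuousOn isClosed_univ
    (ae_of_all _ fun _ => Set.mem_univ _) hint hexp
  rw [integral_add ((integrable_count ν hA).const_mul c) (integrable_const d),
    integral_const_mul, integral_count ν hA, integral_const] at h
  refine (ENNReal.ofReal_le_ofReal (by simpa using h)).trans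
    (ofReal_integral_eq_lintegral_ofReal hexp (ae_of_all _ fun _ => (Real.exp_pos _).le)).le

/-- The coordinates of the pairs are exchanged at the indices `i` with `σ i`. -/
def swapAt (σ : Fin n → Bool) (z : Fin n → E × E) : Fin n → E × E :=
  fun i => if σ i then (z i).swap else z i

/-- Only the two members of each pair need a common law, which is why the observations may have
different distributions. -/
theorem measurePreserving_swapAt (σ : Fin n → Bool) :
    MeasurePreserving (swapAt (E := E) σ) (Measure.pi fun i => (ν i).prod (ν i))
      (Measure.pi fun i => (ν i).prod (ν i)) := by
  refine measurePreserving_pi (f := fun i (y : E × E) => if σ i then y.swap else y) _ _ fun i => ?_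
  cases σ i
  · exact MeasurePreserving.id ((ν i).prod (ν i))
  · simpa using Measure.measurePreserving_swap

/-- The function `∑ᵢ c 1_A(zᵢ.2) + d 1_A(zᵢ.1)`, exponentiated. -/
noncomputable def pairExp (c d : ℝ) (z : Fin n → E × E) (A : Set E) : ENNReal :=
  ENNReal.ofReal (Real.exp (c * count (fun i => (z i).2) A + d * count (fun i => (z i).1) A))

theorem measurable_pairExp (c d : ℝ) {A : Set E} (hA : MeasurableSet A) :
    Measurable fun z : Fin n → E × E => pairExp c d z A := by
  have h1 : Measurable fun z : Fin n → E × E => count (fun i => (z i).2) A :=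
    (measurable_count hA).comp
      (measurable_pi_lambda _ fun i => measurable_snd.comp (measurable_pi_apply i))
  have h2 : Measurable fun z : Fin n → E × E => count (fun i => (z i).1) A :=
    (measurable_count hA).comp
      (measurable_pi_lambda _ fun i => measurable_fst.comp (measurable_pi_apply i))
  exact ENNReal.measurable_ofReal.comp
    (Real.measurable_exp.comp ((h1.const_mul c).add (h2.const_mul d)))

/-- The weight of a pair of traces after exchange of the coordinates at the indices `i` with
`σ i`. -/
noncomputable def swapFactor (c d : ℝ) (S T : Finset (Fin n)) (i : Fin n) (b : Bool) : ENNReal :=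
  ENNReal.ofReal (Real.exp (if b then
      c * (if i ∈ S then 1 else 0) + d * (if i ∈ T then 1 else 0)
    else c * (if i ∈ T then 1 else 0) + d * (if i ∈ S then 1 else 0)))

/-- If exactly one of the two points lies in the set, the sum is `e^c + e^d`; if both do, it is `2
e^(c+d)`, at most 2 by the arithmetic-geometric mean inequality. -/
theorem sum_swapFactor_le {c d : ℝ} (h : Real.exp c + Real.exp d ≤ 2) (S T : Finset (Fin n))
    (i : Fin n) : ∑ b, swapFactor c d S T i b ≤ 2 := by
  have h2 : Real.exp (c + d) ≤ 1 := by
    rw [Real.exp_add]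
    nlinarith [sq_nonneg (Real.exp c - Real.exp d), Real.exp_pos c, Real.exp_pos d]
  rw [Fintype.sum_bool]
  unfold swapFactor
  rw [← ENNReal.ofReal_add (Real.exp_pos _).le (Real.exp_pos _).le,
    show (2 : ENNReal) = ENNReal.ofReal 2 by simp]
  refine ENNReal.ofReal_le_ofReal ?_
  by_cases hS : i ∈ S <;> by_cases hT : i ∈ T <;> simp [hS, hT] <;> linarith

/-- The set enters only through the two traces of the unswapped sample, so one finite family of
traces serves all exchanges `σ`. -/
theorem pairExp_swapAt {E : Type*} {n : ℕ} (c d : ℝ) (σ : Fin n → Bool) (z : Fin n → E × E) (A : Set E) :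
    pairExp c d (swapAt σ z) A
      = ∏ i, swapFactor c d (trace (fun i => (z i).1) A) (trace (fun i => (z i).2) A) i (σ i) := by
  unfold pairExp swapFactor count
  rw [← ENNReal.ofReal_prod_of_nonneg fun i _ => (Real.exp_pos _).le, ← Real.exp_sum,
    Finset.mul_sum, Finset.mul_sum, ← Finset.sum_add_distrib]
  congr 2
  refine Finset.sum_congr rfl fun i _ => ?_
  classical
  by_cases h : σ i <;> simp [swapAt, h, Set.indicator_apply, mem_trace]

/-- Among all exchanges of coordinates, the average of the supremum is at most the number
of traces. -/
theorem sum_iSup_pairExp_swapAt_le {E : Type*} {n : ℕ} {c d : ℝ} (h : Real.exp c + Real.exp d ≤ 2)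
    (𝒟 : Set (Set E)) (N : ℕ) (hN : ∀ s : Fin n → E, (traces 𝒟 s).card ≤ N)
    (z : Fin n → E × E) :
    ∑ σ : Fin n → Bool, ⨆ A ∈ 𝒟, pairExp c d (swapAt σ z) A ≤ 2 ^ n * (N : ENNReal) ^ 2 := by
  set 𝒯 := traces 𝒟 (fun i => (z i).1) ×ˢ traces 𝒟 (fun i => (z i).2) with h𝒯
  have hsup : ∀ σ : Fin n → Bool, ⨆ A ∈ 𝒟, pairExp c d (swapAt σ z) A
      ≤ ∑ t ∈ 𝒯, ∏ i, swapFactor c d t.1 t.2 i (σ i) := by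
    intro σ
    refine iSup₂_le fun A hA => ?_
    rw [pairExp_swapAt]
    refine Finset.single_le_sum (f := fun t : Finset (Fin n) × Finset (Fin n) =>
      ∏ i, swapFactor c d t.1 t.2 i (σ i)) (fun _ _ => zero_le)
      (a := (trace (fun i => (z i).1) A, trace (fun i => (z i).2) A)) ?_
    exact Finset.mem_product.2 ⟨mem_traces.2 ⟨A, hA, rfl⟩, mem_traces.2 ⟨A, hA, rfl⟩⟩
  calc ∑ σ : Fin n → Bool, ⨆ A ∈ 𝒟, pairExp c d (swapAt σ z) A
      ≤ ∑ σ : Fin n → Bool, ∑ t ∈ 𝒯, ∏ i, swapFactor c d t.1 t.2 i (σ i) :=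
        Finset.sum_le_sum fun σ _ => hsup σ
    _ = ∑ t ∈ 𝒯, ∑ σ : Fin n → Bool, ∏ i, swapFactor c d t.1 t.2 i (σ i) := Finset.sum_comm
    -- The exchanges at distinct indices are free of each other: the sum over `σ` of products is a
    -- product of two-term sums.
    _ = ∑ t ∈ 𝒯, ∏ i, ∑ b, swapFactor c d t.1 t.2 i b := by
        refine Finset.sum_congr rfl fun t _ => ?_
        rw [Finset.prod_univ_sum, Fintype.piFinset_univ]
    _ ≤ ∑ _t ∈ 𝒯, 2 ^ n := by
        refine Finset.sum_le_sum fun t _ => ?_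
        refine (Finset.prod_le_prod' fun i _ => sum_swapFactor_le h t.1 t.2 i).trans ?_
        simp
    _ ≤ 2 ^ n * (N : ENNReal) ^ 2 := by
        rw [Finset.sum_const, nsmul_eq_mul, mul_comm]
        gcongr
        rw [h𝒯, Finset.card_product, sq]
        exact_mod_cast Nat.mul_le_mul (hN _) (hN _)

/-- Every exchange preserves the law of the pairs, so the integral equals its average over the `2 ^
n` exchanges, which is bounded pointwise. -/
theorem lintegral_iSup_pairExp_le {c d : ℝ} (h : Real.exp c + Real.exp d ≤ 2)
    {𝒟 : Set (Set E)} (h𝒟 : 𝒟.Countable) (hm : ∀ A ∈ 𝒟, MeasurableSet A)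
    (N : ℕ) (hN : ∀ s : Fin n → E, (traces 𝒟 s).card ≤ N) :
    ∫⁻ z, ⨆ A ∈ 𝒟, pairExp c d z A ∂(Measure.pi fun i => (ν i).prod (ν i))
      ≤ (N : ENNReal) ^ 2 := by
  have hmeas : Measurable fun z : Fin n → E × E => ⨆ A ∈ 𝒟, pairExp c d z A :=
    Measurable.biSup 𝒟 h𝒟 fun A hA => measurable_pairExp c d (hm A hA)
  set Q := Measure.pi fun i => (ν i).prod (ν i) with hQ
  set I := ∫⁻ z, ⨆ A ∈ 𝒟, pairExp c d z A ∂Q with hI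
  have hsum : (2 : ENNReal) ^ n * I
      = ∫⁻ z, ∑ σ : Fin n → Bool, ⨆ A ∈ 𝒟, pairExp c d (swapAt σ z) A ∂Q := by
    have hmeas' : ∀ σ ∈ (Finset.univ : Finset (Fin n → Bool)),
        Measurable fun z : Fin n → E × E => ⨆ A ∈ 𝒟, pairExp c d (swapAt σ z) A := fun σ _ =>
      hmeas.comp (measurePreserving_swapAt ν σ).measurable
    rw [lintegral_finsetSum _ hmeas']
    have : ∀ σ : Fin n → Bool, ∫⁻ z, ⨆ A ∈ 𝒟, pairExp c d (swapAt σ z) A ∂Q = I := fun σ =>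
      (measurePreserving_swapAt ν σ).lintegral_comp hmeas
    simp [this]
  have hle : (2 : ENNReal) ^ n * I ≤ 2 ^ n * (N : ENNReal) ^ 2 := by
    rw [hsum]
    refine (lintegral_mono fun z => sum_iSup_pairExp_swapAt_le h 𝒟 N hN z).trans ?_
    simp [hQ]
  exact (ENNReal.mul_le_mul_iff_right (by simp) (by finiteness)).1 hle

/-- An exponential moment inequality, uniform over a class with few traces. -/
theorem lintegral_iSup_exp_le {c d : ℝ} (h : Real.exp c + Real.exp d ≤ 2)
    {𝒟 : Set (Set E)} (h𝒟 : 𝒟.Countable) (hm : ∀ A ∈ 𝒟, MeasurableSet A)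
    (N : ℕ) (hN : ∀ s : Fin n → E, (traces 𝒟 s).card ≤ N) :
    ∫⁻ s, ⨆ A ∈ 𝒟, ENNReal.ofReal (Real.exp (c * meanCount ν A + d * count s A))
      ∂(Measure.pi ν) ≤ (N : ENNReal) ^ 2 := by
  let e := MeasurableEquiv.arrowProdEquivProdArrow E E (Fin n)
  have he : MeasurePreserving e (Measure.pi fun i => (ν i).prod (ν i))
      ((Measure.pi ν).prod (Measure.pi ν)) :=
    measurePreserving_arrowProdEquivProdArrow E E (Fin n) ν ν
  let F : (Fin n → E) × (Fin n → E) → ENNReal := fun y => ⨆ A ∈ 𝒟,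
    ENNReal.ofReal (Real.exp (c * count y.2 A + d * count y.1 A))
  have hF : Measurable F := Measurable.biSup 𝒟 h𝒟 fun A hA =>
    ENNReal.measurable_ofReal.comp (Real.measurable_exp.comp
      ((((measurable_count (hm A hA)).comp measurable_snd).const_mul c).add
        (((measurable_count (hm A hA)).comp measurable_fst).const_mul d)))
  calc ∫⁻ s, ⨆ A ∈ 𝒟, ENNReal.ofReal (Real.exp (c * meanCount ν A + d * count s A))
        ∂(Measure.pi ν)
      ≤ ∫⁻ s, ∫⁻ t, F (s, t) ∂(Measure.pi ν) ∂(Measure.pi ν) := by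
        refine lintegral_mono fun s => iSup₂_le fun A hA => ?_
        refine (exp_meanCount_le ν (hm A hA) c (d * count s A)).trans ?_
        exact lintegral_mono fun t => le_iSup₂ (f := fun A (_ : A ∈ 𝒟) =>
          ENNReal.ofReal (Real.exp (c * count t A + d * count s A))) A hA
    _ = ∫⁻ y, F y ∂((Measure.pi ν).prod (Measure.pi ν)) :=
        (lintegral_prod F hF.aemeasurable).symm
    _ = ∫⁻ z, F (e z) ∂(Measure.pi fun i => (ν i).prod (ν i)) := (he.lintegral_comp hF).symm
    _ ≤ (N : ENNReal) ^ 2 := lintegral_iSup_pairExp_le ν h h𝒟 hm N hN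

/-- The corresponding deviation inequality. -/
theorem measure_exists_lt_le {c d : ℝ} (h : Real.exp c + Real.exp d ≤ 2)
    {𝒟 : Set (Set E)} (h𝒟 : 𝒟.Countable) (hm : ∀ A ∈ 𝒟, MeasurableSet A)
    (N : ℕ) (hN : ∀ s : Fin n → E, (traces 𝒟 s).card ≤ N) (L : ℝ) :
    Measure.pi ν {s | ∃ A ∈ 𝒟, L < c * meanCount ν A + d * count s A}
      ≤ ENNReal.ofReal (N ^ 2 * Real.exp (-L)) := by
  have hmeas : Measurable fun s : Fin n → E => ⨆ A ∈ 𝒟,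
      ENNReal.ofReal (Real.exp (c * meanCount ν A + d * count s A)) :=
    Measurable.biSup 𝒟 h𝒟 fun A hA => ENNReal.measurable_ofReal.comp
      (Real.measurable_exp.comp (((measurable_count (hm A hA)).const_mul d).const_add _))
  have hpos : ENNReal.ofReal (Real.exp L) ≠ 0 := by simp [Real.exp_pos]
  calc Measure.pi ν {s | ∃ A ∈ 𝒟, L < c * meanCount ν A + d * count s A}
      ≤ Measure.pi ν {s | ENNReal.ofReal (Real.exp L) ≤ ⨆ A ∈ 𝒟,
          ENNReal.ofReal (Real.exp (c * meanCount ν A + d * count s A))} := by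
        refine measure_mono ?_
        rintro s ⟨A, hA, hL⟩
        exact (ENNReal.ofReal_le_ofReal (Real.exp_le_exp.2 hL.le)).trans
          (le_iSup₂ (f := fun A (_ : A ∈ 𝒟) =>
            ENNReal.ofReal (Real.exp (c * meanCount ν A + d * count s A))) A hA)
    _ ≤ _ := meas_ge_le_lintegral_div hmeas.aemeasurable hpos ENNReal.ofReal_ne_top
    _ ≤ (N : ENNReal) ^ 2 / ENNReal.ofReal (Real.exp L) := by
        gcongr
        exact lintegral_iSup_exp_le ν h h𝒟 hm N hN
    _ = ENNReal.ofReal (N ^ 2 * Real.exp (-L)) := by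
        rw [Real.exp_neg, ← div_eq_mul_inv, ENNReal.ofReal_div_of_pos (Real.exp_pos _),
          ENNReal.ofReal_pow (Nat.cast_nonneg _), ENNReal.ofReal_natCast]

end Measures

/-! ### Numerical inequalities and choice of the parameter -/

/-- Admissible exponents for the upper deviations of the mean over the count. The quadratic
correction `2 u²` absorbs the second-order terms in `e^t ≤ 1 + t + t²`. -/
theorem exp_sub_add_exp_neg_le {u : ℝ} (h0 : 0 ≤ u) (h1 : u ≤ 1 / 4) :
    Real.exp (u - 2 * u ^ 2) + Real.exp (-u) ≤ 2 := by
  have ha := (abs_le.1 (Real.abs_exp_sub_one_sub_id_le (x := u - 2 * u ^ 2)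
    (abs_le.2 ⟨by nlinarith, by nlinarith⟩))).2
  have hb := (abs_le.1 (Real.abs_exp_sub_one_sub_id_le (x := -u)
    (abs_le.2 ⟨by linarith, by linarith⟩))).2
  have hc : (u - 2 * u ^ 2) ^ 2 ≤ u ^ 2 :=
    pow_le_pow_left₀ (by nlinarith) (by nlinarith) 2
  nlinarith

/-- Opposite deviations. Here `e^t ≤ 1 + t + t²` would leave an excess `4 u³ + 4 u⁴`, hence the
sharper third-order bound on `e^u` and the reciprocal of a quadratic lower bound for the other term.
-/
theorem exp_neg_sub_add_exp_le {u : ℝ} (h0 : 0 ≤ u) (h1 : u ≤ 1 / 4) :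
    Real.exp (-u - 2 * u ^ 2) + Real.exp u ≤ 2 := by
  have ha := Real.exp_bound' h0 (by linarith) (n := 3) (by norm_num)
  norm_num [Finset.sum_range_succ, Nat.factorial] at ha
  have hu2 : 0 ≤ u ^ 2 := sq_nonneg u
  have hu3 : 0 ≤ u ^ 3 := pow_nonneg h0 3
  have hb := Real.quadratic_le_exp_of_nonneg (x := u + 2 * u ^ 2) (by positivity)
  have hpos : 0 < 1 + (u + 2 * u ^ 2) + (u + 2 * u ^ 2) ^ 2 / 2 := by positivity
  have hc : Real.exp (-u - 2 * u ^ 2) ≤ (1 + (u + 2 * u ^ 2) + (u + 2 * u ^ 2) ^ 2 / 2)⁻¹ := by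
    rw [show -u - 2 * u ^ 2 = -(u + 2 * u ^ 2) by ring, Real.exp_neg]
    exact inv_anti₀ hpos hb
  have hd : (1 + (u + 2 * u ^ 2) + (u + 2 * u ^ 2) ^ 2 / 2)⁻¹
      ≤ 1 - u - u ^ 2 / 2 - u ^ 3 * (2 / 9) := by
    rw [inv_le_iff_one_le_mul₀ hpos]
    have h2 : u ^ 3 ≤ u ^ 2 / 4 := by nlinarith
    have h3 : u ^ 4 ≤ u ^ 2 / 16 := by nlinarith
    have h4 : u ^ 5 ≤ u ^ 2 / 64 := by nlinarith
    have h5 : u ^ 6 ≤ u ^ 2 / 256 := by nlinarith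
    have h6 : u ^ 7 ≤ u ^ 2 / 1024 := by nlinarith
    nlinarith
  linarith

/-- Optimisation of a family of linear bounds over a dyadic grid of parameters. -/
theorem le_sqrt_of_forall_grid {G M D : ℝ} {n K : ℕ} (hG : 1 / 4 ≤ G) (hM : 0 ≤ M) (hn : 1 ≤ n)
    (hMn : M ≤ n) (hK : 1 ≤ K) (hnK : n ≤ 2 ^ K)
    (hD : ∀ k < K, D ≤ 2 * ((1 / 2) ^ k / 4) * M + 2 * G / ((1 / 2) ^ k / 4)) :
    D ≤ 6 * √(G * M) + 8 * G := by
  classical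
  have hS := Real.sqrt_nonneg (G * M)
  rcases le_or_gt M (16 * G) with hcase | hcase
  -- The ideal parameter `√(G / M)` is at least `1/4`, so the largest grid point `1/4` is used; it
  -- produces the term `8 G`.
  · have h0 := hD 0 (by omega)
    have : M / 4 ≤ √(G * M) := Real.le_sqrt_of_sq_le (by nlinarith)
    norm_num at h0
    linarith
  -- The grid reaches below `√(G / M)`: its last point is `2^(-K) / 2`, and `M ≤ n ≤ 2^K` gives a
  -- left side of at most `1/8 < 1/4 ≤ G`.
  · have hlast : M * ((1 / 2 : ℝ) ^ (K - 1) / 4) ^ 2 < G := by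
      have hpow : (1 / 2 : ℝ) ^ (K - 1) = 2 * (1 / 2) ^ K := by
        obtain ⟨j, rfl⟩ : ∃ j, K = j + 1 := ⟨K - 1, by omega⟩
        rw [Nat.add_sub_cancel, pow_succ]
        ring
      have hn' : (1 : ℝ) ≤ n := by exact_mod_cast hn
      have hnK' : (n : ℝ) * (1 / 2) ^ K ≤ 1 := by
        rw [one_div, inv_pow, ← div_eq_mul_inv, div_le_one (by positivity)]
        exact_mod_cast hnK
      have hp : (0 : ℝ) ≤ (1 / 2) ^ K := by positivity
      have hp1 : (1 / 2 : ℝ) ^ K ≤ 1 / 2 := by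
        calc (1 / 2 : ℝ) ^ K ≤ (1 / 2) ^ 1 :=
              pow_le_pow_of_le_one (by norm_num) (by norm_num) hK
          _ = 1 / 2 := pow_one _
      rw [hpow]
      have h1 : M * (1 / 2) ^ K ≤ 1 := (mul_le_mul_of_nonneg_right hMn hp).trans hnK'
      have h2 : M * (1 / 2) ^ K * (1 / 2) ^ K ≤ 1 * (1 / 2) := by gcongr
      nlinarith
    -- The index just before the first grid point below `√(G / M)` gives `√(G / M) ≤ u ≤ 2 √(G /
    -- M)`; the two terms are then at most `4 √(G M)` and `2 √(G M)`.
    have hex : ∃ j, M * ((1 / 2 : ℝ) ^ j / 4) ^ 2 < G := ⟨K - 1, hlast⟩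
    obtain ⟨k, hk⟩ : ∃ k, Nat.find hex = k + 1 := by
      refine Nat.exists_eq_succ_of_ne_zero fun h0 => ?_
      have := Nat.find_spec hex
      rw [h0] at this
      norm_num at this
      linarith
    have hkK : k < K := by
      have := Nat.find_min' hex hlast
      omega
    have hup := Nat.find_spec hex
    have hlow := not_lt.1 (Nat.find_min hex (m := k) (by omega))
    rw [hk, pow_succ (1 / 2 : ℝ) k] at hup
    have hu : 0 < (1 / 2 : ℝ) ^ k / 4 := by positivity
    have hDk := hD k hkK
    generalize hv : (1 / 2 : ℝ) ^ k / 4 = u at *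
    have hup' : M * u ^ 2 ≤ 4 * G := by
      have : (1 / 2 : ℝ) ^ k * (1 / 2) / 4 = u / 2 := by rw [← hv]; ring
      rw [this] at hup
      nlinarith
    have h1 : u * M / 2 ≤ √(G * M) := Real.le_sqrt_of_sq_le (by nlinarith)
    have h2 : G / u ≤ √(G * M) := by
      refine Real.le_sqrt_of_sq_le ?_
      rw [div_pow, div_le_iff₀ (by positivity)]
      nlinarith
    have h3 : 2 * G / u = 2 * (G / u) := by ring
    linarith

theorem one_le_sum_choose (n V : ℕ) :
    1 ≤ ∑ j ∈ Finset.range (min V n + 1), n.choose j :=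
  calc 1 = n.choose 0 := by simp
    _ ≤ _ := Finset.single_le_sum (f := fun j => n.choose j) (fun _ _ => Nat.zero_le _)
      (Finset.mem_range.2 (Nat.succ_pos _))

/-- `⌈log₂ n⌉` is the number of grid points in the union bound, and the sum is Sauer's bound on the
number of traces. -/
theorem exp_Gam {n V : ℕ} (hn : 2 ≤ n) : Real.exp (Gam n V)
    = Nat.clog 2 n * (2 * ((∑ j ∈ Finset.range (min V n + 1), n.choose j : ℕ) : ℝ)) := by
  have hK : 0 < Nat.clog 2 n := Nat.clog_pos (by norm_num) hn
  have hN := one_le_sum_choose n V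
  have hc : ⌈Real.logb 2 n⌉ = (Nat.clog 2 n : ℤ) := by
    have := Real.ceil_logb_natCast (b := 2) (r := (n : ℝ)) (by positivity)
    rw [Int.clog_natCast] at this
    exact_mod_cast this
  unfold Gam
  rw [Real.exp_add, hc, Real.exp_log (by exact_mod_cast hK), Real.exp_log]
  · push_cast; rfl
  · rw [← Nat.cast_sum]
    have : (1 : ℝ) ≤ ((∑ j ∈ Finset.range (min V n + 1), n.choose j : ℕ) : ℝ) := by
      exact_mod_cast hN
    linarith

theorem quarter_le_Gam {n V : ℕ} (hn : 2 ≤ n) : 1 / 4 ≤ Gam n V := by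
  have hK : (1 : ℝ) ≤ Nat.clog 2 n := by exact_mod_cast Nat.clog_pos (by norm_num) hn
  have hN : (1 : ℝ) ≤ ((∑ j ∈ Finset.range (min V n + 1), n.choose j : ℕ) : ℝ) := by
    exact_mod_cast one_le_sum_choose n V
  have h : Real.exp (Real.log 2) ≤ Real.exp (Gam n V) := by
    rw [exp_Gam hn, Real.exp_log (by norm_num)]
    nlinarith
  have := Real.exp_le_exp.1 h
  linarith [Real.log_two_gt_d9]

/-! ### Uniform deviation inequality over a countable class -/

section Measures

variable {E : Type*} [MeasurableSpace E] {n : ℕ} (ν : Fin n → Measure E)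

theorem meanCount_nonneg (A : Set E) : 0 ≤ meanCount ν A :=
  Finset.sum_nonneg fun _ _ => measureReal_nonneg

variable [∀ i, IsProbabilityMeasure (ν i)]

theorem meanCount_le (A : Set E) : meanCount ν A ≤ n := by
  calc meanCount ν A ≤ ∑ _i : Fin n, (1 : ℝ) := Finset.sum_le_sum fun i _ => measureReal_le_one
    _ = n := by simp

/-- A uniform relative deviation inequality for independent, not necessarily identically
distributed observations. -/
theorem measure_exists_deviation_le (hn : 2 ≤ n) {V : ℕ} {x : ℝ} (hx : 0 ≤ x)
    {𝒟 : Set (Set E)} (h𝒟 : 𝒟.Countable) (hm : ∀ A ∈ 𝒟, MeasurableSet A)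
    (hN : ∀ s : Fin n → E,
      (traces 𝒟 s).card ≤ ∑ j ∈ Finset.range (min V n + 1), n.choose j) :
    Measure.pi ν {s | ∃ A ∈ 𝒟, 6 * √((Gam n V + x) * meanCount ν A) + 8 * (Gam n V + x)
        < |meanCount ν A - count s A|}
      ≤ ENNReal.ofReal (2 * Real.exp (-x)) := by
  set G := Gam n V + x with hG
  set N := ∑ j ∈ Finset.range (min V n + 1), n.choose j with hNdef
  set K := Nat.clog 2 n with hKdef
  have hK : 1 ≤ K := Nat.clog_pos (by norm_num) hn
  have hnK : n ≤ 2 ^ K := Nat.le_pow_clog (by norm_num) n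
  have hG4 : 1 / 4 ≤ G := by linarith [quarter_le_Gam (V := V) hn]
  let u : ℕ → ℝ := fun k => (1 / 2) ^ k / 4
  have hu0 : ∀ k, 0 < u k := fun k => by positivity
  have hu1 : ∀ k, u k ≤ 1 / 4 := fun k => by
    have : (1 / 2 : ℝ) ^ k ≤ 1 := pow_le_one₀ (by norm_num) (by norm_num)
    simp only [u]; linarith
  -- The sign `r = ±1` selects the direction of the deviation. The level is `2 G` because the moment
  -- bound is `N ^ 2`, which `e^(-2G)` must compensate.
  let B : ℕ → ℝ → Set (Fin n → E) := fun k r =>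
    {s | ∃ A ∈ 𝒟, 2 * G < (r * u k - 2 * u k ^ 2) * meanCount ν A + (-r * u k) * count s A}
  have hB1 : ∀ k, Measure.pi ν (B k 1) ≤ ENNReal.ofReal (N ^ 2 * Real.exp (-(2 * G))) := fun k =>
    measure_exists_lt_le ν (by
      simpa using exp_sub_add_exp_neg_le (hu0 k).le (hu1 k)) h𝒟 hm N hN (2 * G)
  have hB2 : ∀ k, Measure.pi ν (B k (-1)) ≤ ENNReal.ofReal (N ^ 2 * Real.exp (-(2 * G))) :=
    fun k => measure_exists_lt_le ν (by
      simpa using exp_neg_sub_add_exp_le (hu0 k).le (hu1 k)) h𝒟 hm N hN (2 * G)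
  have hsub : {s | ∃ A ∈ 𝒟, 6 * √(G * meanCount ν A) + 8 * G < |meanCount ν A - count s A|}
      ⊆ ⋃ k ∈ Finset.range K, (B k 1 ∪ B k (-1)) := by
    rintro s ⟨A, hA, hlt⟩
    by_contra hs
    simp only [Set.mem_iUnion, Set.mem_union, Finset.mem_range, not_exists, not_or] at hs
    refine not_le.2 hlt (le_sqrt_of_forall_grid hG4 (meanCount_nonneg ν A) (by omega)
      (meanCount_le ν A) hK hnK fun k hk => ?_)
    obtain ⟨h1, h2⟩ := hs k hk
    have h1' : ∀ A ∈ 𝒟, (1 * u k - 2 * u k ^ 2) * meanCount ν A + (-1 * u k) * count s A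
        ≤ 2 * G := fun A hA => not_lt.1 fun h => h1 ⟨A, hA, h⟩
    have h2' : ∀ A ∈ 𝒟, (-1 * u k - 2 * u k ^ 2) * meanCount ν A + (-(-1) * u k) * count s A
        ≤ 2 * G := fun A hA => not_lt.1 fun h => h2 ⟨A, hA, h⟩
    have ha := h1' A hA
    have hb := h2' A hA
    have hdiv : ∀ y, u k * y ≤ 2 * G + 2 * u k ^ 2 * meanCount ν A →
        y ≤ 2 * u k * meanCount ν A + 2 * G / u k := by
      intro y hy
      have : 2 * u k * meanCount ν A + 2 * G / u k
          = (2 * G + 2 * u k ^ 2 * meanCount ν A) / u k := by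
        field_simp [(hu0 k).ne']
        ring
      rw [this, le_div_iff₀ (hu0 k)]
      linarith
    exact abs_le'.2 ⟨hdiv _ (by linarith), hdiv _ (by linarith)⟩
  have hexp : K * ((N : ℝ) ^ 2 * Real.exp (-(2 * G))) ≤ Real.exp (-x) := by
    have hGe : Real.exp G = K * (2 * N) * Real.exp x := by
      rw [hG, Real.exp_add, exp_Gam hn]
    have hN1 : (1 : ℝ) ≤ N := by exact_mod_cast one_le_sum_choose n V
    have hK1 : (1 : ℝ) ≤ K := by exact_mod_cast hK
    have hx1 : 1 ≤ Real.exp x := Real.one_le_exp hx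
    rw [Real.exp_neg, Real.exp_neg, show 2 * G = G + G by ring, Real.exp_add, hGe,
      ← mul_assoc, ← div_eq_mul_inv, div_le_iff₀ (by positivity), inv_mul_eq_div,
      le_div_iff₀ (by positivity)]
    have hw : (0 : ℝ) ≤ K * N ^ 2 * Real.exp x := by positivity
    have hKx : 1 ≤ K * Real.exp x := one_le_mul_of_one_le_of_one_le hK1 hx1
    nlinarith
  calc Measure.pi ν {s | ∃ A ∈ 𝒟, 6 * √(G * meanCount ν A) + 8 * G
        < |meanCount ν A - count s A|}
      ≤ Measure.pi ν (⋃ k ∈ Finset.range K, (B k 1 ∪ B k (-1))) := measure_mono hsub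
    _ ≤ ∑ k ∈ Finset.range K, Measure.pi ν (B k 1 ∪ B k (-1)) := measure_biUnion_finset_le _ _
    _ ≤ ∑ _k ∈ Finset.range K, ENNReal.ofReal (2 * (N ^ 2 * Real.exp (-(2 * G)))) := by
        refine Finset.sum_le_sum fun k _ => (measure_union_le _ _).trans ?_
        rw [two_mul, ENNReal.ofReal_add (by positivity) (by positivity)]
        exact add_le_add (hB1 k) (hB2 k)
    _ = ENNReal.ofReal (K * (2 * (N ^ 2 * Real.exp (-(2 * G))))) := by
        rw [Finset.sum_const, Finset.card_range, nsmul_eq_mul,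
          ENNReal.ofReal_mul (Nat.cast_nonneg _), ENNReal.ofReal_natCast]
    _ ≤ ENNReal.ofReal (2 * Real.exp (-x)) := ENNReal.ofReal_le_ofReal (by linarith)

end Measures

/-! ### From the countable subclass to the whole class -/

section Extension

variable {E : Type*} [MeasurableSpace E] {n : ℕ} (ν : Fin n → Measure E)

theorem tendsto_count {E : Type*} {n : ℕ} {A : Set E} {D : ℕ → Set E} (s : Fin n → E)
    (hD : ∀ y, ∀ᶠ k in atTop, (y ∈ D k ↔ y ∈ A)) :
    Tendsto (fun k => count s (D k)) atTop (nhds (count s A)) := by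
  classical
  refine tendsto_finsetSum _ fun i _ => tendsto_const_nhds.congr' ?_
  filter_upwards [hD (s i)] with k hk
  simp [Set.indicator_apply, hk]

theorem tendsto_meanCount [∀ i, IsProbabilityMeasure (ν i)] {A : Set E} {D : ℕ → Set E}
    (hm : ∀ k, MeasurableSet (D k)) (hD : ∀ y, ∀ᶠ k in atTop, (y ∈ D k ↔ y ∈ A)) :
    Tendsto (fun k => meanCount ν (D k)) atTop (nhds (meanCount ν A)) :=
  tendsto_finsetSum _ fun i _ => (ENNReal.tendsto_toReal (measure_ne_top _ _)).comp
    (tendsto_measure_of_tendsto_indicator_of_isFiniteMeasure atTop (ν i) hm hD)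

/-- Both sides are continuous along pointwise convergence of indicators: counts are finite sums, and
means converge by dominated convergence for finite measures. -/
theorem abs_sub_count_le_of_tendsto [∀ i, IsProbabilityMeasure (ν i)] {A : Set E}
    {D : ℕ → Set E} (hm : ∀ k, MeasurableSet (D k))
    (hD : ∀ y, ∀ᶠ k in atTop, (y ∈ D k ↔ y ∈ A)) (s : Fin n → E) (G : ℝ)
    (h : ∀ k, |meanCount ν (D k) - count s (D k)| ≤ 6 * √(G * meanCount ν (D k)) + 8 * G) :
    |meanCount ν A - count s A| ≤ 6 * √(G * meanCount ν A) + 8 * G := by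
  have hM := tendsto_meanCount ν hm hD
  exact le_of_tendsto_of_tendsto' (hM.sub (tendsto_count s hD)).abs
    ((((hM.const_mul G).sqrt).const_mul 6).add_const (8 * G)) h

theorem traces_mono {E : Type*} {n : ℕ} {𝒟 𝒞 : Set (Set E)} (h : 𝒟 ⊆ 𝒞) (s : Fin n → E) :
    traces 𝒟 s ⊆ traces 𝒞 s := by
  intro T hT
  obtain ⟨A, hA, rfl⟩ := mem_traces.1 hT
  exact mem_traces.2 ⟨A, h hA, rfl⟩

/-- With probability at least `1 - 2 e^{-x}`, the empirical measure is close to its mean,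
uniformly over the class. -/
theorem exists_event_deviation_le {𝒞 : Set (Set E)} (h𝒞 : ∀ A ∈ 𝒞, MeasurableSet A)
    (hpm : PointwiseMeasurable 𝒞) {V : ℕ} (hV : vcDim 𝒞 = (V : ℕ∞)) (hn : 2 ≤ n)
    {Ω : Type*} [MeasurableSpace Ω] (P : Measure Ω) [IsProbabilityMeasure P]
    (X : Fin n → Ω → E) (hX : ∀ i, Measurable (X i)) (hind : iIndepFun X P)
    {x : ℝ} (hx : 0 ≤ x) :
    ∃ A : Set Ω, MeasurableSet A ∧ 1 - 2 * Real.exp (-x) ≤ P.real A ∧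
      ∀ ω ∈ A, ∀ B ∈ 𝒞,
        |meanCount (fun i => P.map (X i)) B - count (fun i => X i ω) B|
          ≤ 6 * √((Gam n V + x) * meanCount (fun i => P.map (X i)) B)
            + 8 * (Gam n V + x) := by
  obtain ⟨𝒟, h𝒟𝒞, h𝒟, happrox⟩ := hpm
  set ν : Fin n → Measure E := fun i => P.map (X i) with hν
  have hprob : ∀ i, IsProbabilityMeasure (ν i) := fun i =>
    Measure.isProbabilityMeasure_map (hX i).aemeasurable
  set G := Gam n V + x
  have hmD : ∀ B ∈ 𝒟, MeasurableSet B := fun B hB => h𝒞 B (h𝒟𝒞 hB)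
  have hY : Measurable fun ω i => X i ω := measurable_pi_lambda _ hX
  have hlaw : P.map (fun ω i => X i ω) = Measure.pi ν :=
    (iIndepFun_iff_map_fun_eq_pi_map fun i => (hX i).aemeasurable).1 hind
  -- Restricting to the countable `𝒟` makes the exceptional set measurable; the bound for `𝒞` is
  -- then recovered at each fixed `ω`.
  set bad : Set (Fin n → E) := {s | ∃ B ∈ 𝒟, 6 * √(G * meanCount ν B) + 8 * G
    < |meanCount ν B - count s B|} with hbad
  have hbadm : MeasurableSet bad := by
    have : bad = ⋃ B ∈ 𝒟, {s | 6 * √(G * meanCount ν B) + 8 * G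
        < |meanCount ν B - count s B|} := by
      ext s; simp [hbad]
    rw [this]
    exact MeasurableSet.biUnion h𝒟 fun B hB => measurableSet_lt measurable_const
      (continuous_abs.measurable.comp ((measurable_count (hmD B hB)).const_sub _))
  have hle : P ((fun ω i => X i ω) ⁻¹' bad) ≤ ENNReal.ofReal (2 * Real.exp (-x)) := by
    rw [← Measure.map_apply hY hbadm, hlaw]
    exact measure_exists_deviation_le ν hn hx h𝒟 hmD fun s =>
      (Finset.card_le_card (traces_mono h𝒟𝒞 s)).trans (card_traces_le hV s)
  refine ⟨((fun ω i => X i ω) ⁻¹' bad)ᶜ, (hY hbadm).compl, ?_, ?_⟩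
  · rw [probReal_compl_eq_one_sub (hY hbadm)]
    have : P.real ((fun ω i => X i ω) ⁻¹' bad) ≤ 2 * Real.exp (-x) :=
      ENNReal.toReal_le_of_le_ofReal (by positivity) hle
    linarith
  · intro ω hω B hB
    obtain ⟨D, hD, hlim⟩ := happrox B hB
    refine abs_sub_count_le_of_tendsto ν (fun k => hmD _ (hD k)) hlim _ G fun k => ?_
    exact not_lt.1 fun h => hω ⟨D k, hD k, h⟩

end Extension

/-! ### Masses, weights and semi-norms -/

section Space

variable {E : Type*} [MeasurableSpace E] {μ : Measure E}

theorem Space.memLp_one (f : Space μ) : MemLp f.fn 1 μ := Lp.mem_Lp_iff_memLp.1 f.2.1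

theorem Space.memLp_top (f : Space μ) : MemLp f.fn ⊤ μ := Lp.mem_Lp_iff_memLp.1 f.2.2

theorem Space.integrable (f : Space μ) : Integrable f.fn μ := memLp_one_iff_integrable.1 f.memLp_one

theorem Space.fn_sub (f g : Space μ) : (f - g).fn =ᵐ[μ] f.fn - g.fn :=
  AEEqFun.coeFn_sub (f : E →ₘ[μ] ℝ) (g : E →ₘ[μ] ℝ)

theorem Space.fn_add (f g : Space μ) : (f + g).fn =ᵐ[μ] f.fn + g.fn :=
  AEEqFun.coeFn_add (f : E →ₘ[μ] ℝ) (g : E →ₘ[μ] ℝ)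

theorem Space.fn_smul (c : ℝ) (f : Space μ) : (c • f).fn =ᵐ[μ] c • f.fn :=
  AEEqFun.coeFn_smul c (f : E →ₘ[μ] ℝ)

theorem mass_sub (f g : Space μ) (A : Set E) : mass (f - g) A = mass f A - mass g A := by
  unfold mass
  rw [← integral_sub f.integrable.integrableOn g.integrable.integrableOn]
  exact integral_congr_ae (ae_restrict_of_ae (Space.fn_sub f g))

theorem mass_add (f g : Space μ) (A : Set E) : mass (f + g) A = mass f A + mass g A := by
  unfold mass
  rw [← integral_add f.integrable.integrableOn g.integrable.integrableOn]
  exact integral_congr_ae (ae_restrict_of_ae (Space.fn_add f g))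

theorem mass_smul (c : ℝ) (f : Space μ) (A : Set E) : mass (c • f) A = c * mass f A := by
  unfold mass
  rw [← integral_const_mul]
  exact integral_congr_ae (ae_restrict_of_ae (Space.fn_smul c f))

theorem mass_zero (A : Set E) : mass (0 : Space μ) A = 0 := by
  simpa using mass_smul 0 (0 : Space μ) A

theorem mass_sum {ι : Type*} (t : Finset ι) (f : ι → Space μ) (A : Set E) :
    mass (∑ i ∈ t, f i) A = ∑ i ∈ t, mass (f i) A := by
  classical
  induction t using Finset.induction_on with
  | empty => simp [mass_zero]
  | insert a t ha ih => rw [Finset.sum_insert ha, Finset.sum_insert ha, mass_add, ih]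

theorem mass_eq_measureReal {Ω : Type*} [MeasurableSpace Ω] {P : Measure Ω} {Y : Ω → E}
    {p : Space μ} (hp : IsDensity P Y p) {A : Set E} (hA : MeasurableSet A) :
    mass p A = (P.map Y).real A := by
  rw [mass, measureReal_def, hp.2, withDensity_apply _ hA]
  exact integral_eq_lintegral_of_nonneg_ae (ae_restrict_of_ae hp.1)
    p.integrable.aestronglyMeasurable.restrict

theorem mass_mixture {Ω : Type*} [MeasurableSpace Ω] {P : Measure Ω} {n : ℕ}
    {X : Fin n → Ω → E} {p : Fin n → Space μ} (hp : ∀ i, IsDensity P (X i) (p i)) {A : Set E}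
    (hA : MeasurableSet A) :
    mass (mixture p) A = (1 / (n : ℝ)) * meanCount (fun i => P.map (X i)) A := by
  rw [mixture, mass_smul, mass_sum, meanCount]
  congr 1
  exact Finset.sum_congr rfl fun i _ => mass_eq_measureReal (hp i) hA

theorem weight_nonneg (h : ℝ) (A : Set E) : 0 ≤ weight μ h A := ENNReal.toReal_nonneg

theorem weight_le {h : ℝ} (hh : 0 < h) (A : Set E) : weight μ h A ≤ 1 / h := by
  have h1 : (μ A + ENNReal.ofReal h)⁻¹ ≤ (ENNReal.ofReal h)⁻¹ := by simp
  have h2 := ENNReal.toReal_mono (by simp [hh]) h1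
  rw [weight]
  simpa [ENNReal.toReal_inv, ENNReal.toReal_ofReal hh.le] using h2

theorem weight_mul_measureReal_le (h : ℝ) (A : Set E) :
    weight μ h A * μ.real A ≤ 1 := by
  rw [weight, measureReal_def, ← ENNReal.toReal_mul]
  refine ENNReal.toReal_le_of_le_ofReal zero_le_one ?_
  rw [ENNReal.ofReal_one]
  calc (μ A + ENNReal.ofReal h)⁻¹ * μ A
      ≤ (μ A + ENNReal.ofReal h)⁻¹ * (μ A + ENNReal.ofReal h) := by gcongr; simp
    _ ≤ 1 := ENNReal.inv_mul_le_one _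

theorem abs_mass_le (f : Space μ) (A : Set E) : |mass f A| ≤ ∫ y, |f.fn y| ∂μ := by
  refine (abs_integral_le_integral_abs).trans ?_
  exact setIntegral_le_integral f.integrable.abs (ae_of_all _ fun _ => abs_nonneg _)

/-- A real supremum defaults to 0 when unbounded, so comparing single sets with `hNorm` requires
this. -/
theorem bddAbove_hNorm (𝒞 : Set (Set E)) {h : ℝ} (hh : 0 < h) (f : Space μ) :
    BddAbove (Set.range fun A : 𝒞 => weight μ h A * |mass f A|) := by
  refine ⟨1 / h * ∫ y, |f.fn y| ∂μ, ?_⟩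
  rintro _ ⟨A, rfl⟩
  exact mul_le_mul (weight_le hh (A : Set E)) (abs_mass_le f (A : Set E)) (abs_nonneg _)
    (one_div_pos.2 hh).le

theorem le_hNorm {𝒞 : Set (Set E)} {h : ℝ} (hh : 0 < h) (f : Space μ) (A : 𝒞) :
    weight μ h A * |mass f A| ≤ hNorm 𝒞 h f :=
  le_ciSup (bddAbove_hNorm 𝒞 hh f) A

theorem hNorm_nonneg (𝒞 : Set (Set E)) (h : ℝ) (f : Space μ) : 0 ≤ hNorm 𝒞 h f :=
  Real.iSup_nonneg fun A => mul_nonneg (weight_nonneg h (A : Set E)) (abs_nonneg _)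

theorem hNorm_sub_comm (𝒞 : Set (Set E)) (h : ℝ) (f g : Space μ) :
    hNorm 𝒞 h (f - g) = hNorm 𝒞 h (g - f) := by
  unfold hNorm
  simp only [mass_sub, abs_sub_comm]

theorem supNorm_nonneg (f : Space μ) : 0 ≤ supNorm f := ENNReal.toReal_nonneg

theorem supNorm_sub_comm (f g : Space μ) : supNorm (f - g) = supNorm (g - f) := by
  unfold supNorm
  rw [eLpNorm_congr_ae (Space.fn_sub f g), eLpNorm_congr_ae (Space.fn_sub g f),
    eLpNorm_sub_comm]

theorem supNorm_add_le (f g : Space μ) : supNorm (f + g) ≤ supNorm f + supNorm g := by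
  unfold supNorm
  rw [eLpNorm_congr_ae (Space.fn_add f g),
    ← ENNReal.toReal_add f.memLp_top.2.ne g.memLp_top.2.ne]
  exact ENNReal.toReal_mono (ENNReal.add_ne_top.2 ⟨f.memLp_top.2.ne, g.memLp_top.2.ne⟩)
    (eLpNorm_add_le f.memLp_top.1 g.memLp_top.1 le_top)

theorem supNorm_zero : supNorm (0 : Space μ) = 0 := by
  have h : (0 : Space μ).fn =ᵐ[μ] 0 := AEEqFun.coeFn_zero
  rw [supNorm, eLpNorm_congr_ae h, eLpNorm_zero, ENNReal.toReal_zero]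

theorem ae_abs_le_supNorm (f : Space μ) : ∀ᵐ y ∂μ, |f.fn y| ≤ supNorm f := by
  have h := ae_le_eLpNormEssSup (f := f.fn) (μ := μ)
  rw [← eLpNorm_exponent_top] at h
  filter_upwards [h] with y hy
  have := ENNReal.toReal_mono f.memLp_top.2.ne hy
  simpa [supNorm] using this

/-- For finite `μ A`, the mass is at most `‖f‖_∞ μ(A)` and the weight cancels `μ(A)`; for infinite
`μ A` the weight vanishes. -/
theorem weight_mul_abs_mass_le_supNorm (f : Space μ) (h : ℝ) (A : Set E) :
    weight μ h A * |mass f A| ≤ supNorm f := by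
  by_cases hA : μ A = ⊤
  · simpa [weight, hA] using supNorm_nonneg f
  · have h1 : |mass f A| ≤ supNorm f * μ.real A := by
      have := norm_setIntegral_le_of_norm_le_const_ae' (f := f.fn) (s := A) (μ := μ)
        (C := supNorm f) (lt_top_iff_ne_top.2 hA)
        ((ae_abs_le_supNorm f).mono fun y hy _ => hy)
      simpa [mass] using this
    calc weight μ h A * |mass f A| ≤ weight μ h A * (supNorm f * μ.real A) :=
          mul_le_mul_of_nonneg_left h1 (weight_nonneg h A)
      _ = supNorm f * (weight μ h A * μ.real A) := by ring
      _ ≤ supNorm f * 1 :=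
          mul_le_mul_of_nonneg_left (weight_mul_measureReal_le h A) (supNorm_nonneg f)
      _ = supNorm f := mul_one _

theorem hNorm_le_supNorm (𝒞 : Set (Set E)) (h : ℝ) (f : Space μ) :
    hNorm 𝒞 h f ≤ supNorm f :=
  Real.iSup_le (fun A => weight_mul_abs_mass_le_supNorm f h A) (supNorm_nonneg f)

theorem unitInf_le {S : Set ℝ} (hS : ∀ r ∈ S, 0 ≤ r) {r : ℝ} (hr : r ∈ S) : unitInf S ≤ r :=
  csInf_le ⟨0, by rintro _ (rfl | hy); exacts [zero_le_one, hS _ hy]⟩ (Set.mem_insert_of_mem _ hr)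

theorem unitInf_nonneg {S : Set ℝ} (hS : ∀ r ∈ S, 0 ≤ r) : 0 ≤ unitInf S :=
  Real.sInf_nonneg (by rintro _ (rfl | hy); exacts [zero_le_one, hS _ hy])

variable {𝒞 : Set (Set E)} {m : Set (Space μ)} {h : ℝ} {C : Space μ → Space μ → 𝒞}

theorem one_sub_eps_nonneg : 0 ≤ 1 - eps 𝒞 m h C := by
  rw [eps, sub_sub_cancel]
  refine unitInf_nonneg ?_
  rintro _ ⟨p, -, q, -, -, rfl⟩
  exact div_nonneg (mul_nonneg (weight_nonneg _ _) (abs_nonneg _)) (hNorm_nonneg _ _ _)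

/-- Clears the denominator in the definition of `eps`; the pairs omitted there satisfy the
inequality trivially. -/
theorem one_sub_eps_mul_hNorm_le {p q : Space μ} (hp : p ∈ m) (hq : q ∈ m) :
    (1 - eps 𝒞 m h C) * hNorm 𝒞 h (p - q)
      ≤ weight μ h (C p q) * |mass (p - q) (C p q)| := by
  have hw : 0 ≤ weight μ h (C p q) * |mass (p - q) (C p q)| :=
    mul_nonneg (weight_nonneg _ _) (abs_nonneg _)
  rcases (hNorm_nonneg 𝒞 h (p - q)).eq_or_lt with h0 | h0
  · rwa [← h0, mul_zero]
  · rw [← le_div_iff₀ h0, eps, sub_sub_cancel]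
    refine unitInf_le ?_ ⟨p, hp, q, hq, h0.ne', rfl⟩
    rintro _ ⟨p, -, q, -, -, rfl⟩
    exact div_nonneg (mul_nonneg (weight_nonneg _ _) (abs_nonneg _)) (hNorm_nonneg _ _ _)

theorem kappa_nonneg : 0 ≤ kappa 𝒞 m h := by
  refine unitInf_nonneg ?_
  rintro _ ⟨p, -, q, -, -, rfl⟩
  exact div_nonneg (hNorm_nonneg _ _ _) (supNorm_nonneg _)

theorem kappa_mul_supNorm_le {p q : Space μ} (hp : p ∈ m) (hq : q ∈ m) :
    kappa 𝒞 m h * supNorm (p - q) ≤ hNorm 𝒞 h (p - q) := by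
  rcases (supNorm_nonneg (p - q)).eq_or_lt with h0 | h0
  · rw [← h0, mul_zero]; exact hNorm_nonneg _ _ _
  · rw [← le_div_iff₀ h0]
    refine unitInf_le ?_ ⟨p, hp, q, hq, ?_, rfl⟩
    · rintro _ ⟨p, -, q, -, -, rfl⟩
      exact div_nonneg (hNorm_nonneg _ _ _) (supNorm_nonneg _)
    · rintro rfl
      rw [sub_self, supNorm_zero] at h0
      exact h0.false

/-! ### Deterministic risk bounds -/

theorem tTest_eq {n : ℕ} (hn : n ≠ 0) (τ : Space μ → Space μ → ℝ) (s : Fin n → E)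
    (p q : Space μ) :
    tTest h C τ s p q = τ p q * weight μ h (C p q) *
      (mass p (C p q) - (1 / (n : ℝ)) * count s (C p q)) := by
  have hn' : (n : ℝ) ≠ 0 := Nat.cast_ne_zero.2 hn
  unfold tTest tFun count
  rw [← Finset.mul_sum, Finset.sum_sub_distrib, Finset.sum_const, Finset.card_univ,
    Fintype.card_fin, nsmul_eq_mul]
  field_simp

/-- The risk bound for hun-estimators, given a uniform bound `Z` on the weighted deviations. -/
theorem one_sub_eps_mul_hNorm_le_of_deviation {n : ℕ} (hn : n ≠ 0) (hh : 0 < h)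
    {τ : Space μ → Space μ → ℝ} (hτ : IsSign C τ) {s : Fin n → E} {pstar : Space μ} {Z : ℝ}
    (hZ : ∀ A : 𝒞, weight μ h A * |mass pstar A - (1 / (n : ℝ)) * count s A| ≤ Z)
    {phat pbar : Space μ} (hphat : phat ∈ m) (hpbar : pbar ∈ m) {δ : ℝ}
    (hδ : tSup m h C τ s phat ≤ tSup m h C τ s pbar + δ) :
    (1 - eps 𝒞 m h C) * hNorm 𝒞 h (pbar - phat)
      ≤ 2 * hNorm 𝒞 h (pstar - pbar) + δ + 2 * Z := by
  have habs : ∀ p q, |τ p q| = 1 := fun p q => by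
    rcases (hτ p q).1 with h | h <;> simp [h]
  have hbound : ∀ (p q a : Space μ) (A : 𝒞),
      |τ p q * weight μ h A * (mass a A - (1 / (n : ℝ)) * count s A)|
        ≤ hNorm 𝒞 h (pstar - a) + Z := by
    intro p q a A
    have h1 := le_hNorm hh (pstar - a) A
    have h2 := hZ A
    rw [mass_sub] at h1
    rw [abs_mul, abs_mul, habs, one_mul, abs_of_nonneg (weight_nonneg h (A : Set E))]
    have h3 : |mass a A - (1 / (n : ℝ)) * count s A|
        ≤ |mass pstar A - mass a A| + |mass pstar A - (1 / (n : ℝ)) * count s A| := by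
      rw [abs_sub_comm (mass pstar (A : Set E)) (mass a A)]
      exact abs_sub_le _ _ _
    have h4 := mul_le_mul_of_nonneg_left h3 (weight_nonneg (μ := μ) h (A : Set E))
    linarith
  have htest : ∀ p q, |tTest h C τ s p q| ≤ hNorm 𝒞 h (pstar - p) + Z := fun p q => by
    rw [tTest_eq hn]
    exact hbound p q p (C p q)
  have hsup : tSup m h C τ s pbar ≤ hNorm 𝒞 h (pstar - pbar) + Z := by
    have : Nonempty m := ⟨⟨pbar, hpbar⟩⟩
    exact ciSup_le fun q => (le_abs_self _).trans (htest pbar q)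
  have hle : tTest h C τ s phat pbar ≤ tSup m h C τ s phat := by
    refine le_ciSup (f := fun q : m => tTest h C τ s phat q) ?_ ⟨pbar, hpbar⟩
    refine ⟨hNorm 𝒞 h (pstar - phat) + Z, ?_⟩
    rintro _ ⟨q, rfl⟩
    exact (le_abs_self _).trans (htest phat q)
  -- The sign `τ` removes the absolute value, and inserting the empirical measure splits the gap
  -- between `phat` and `pbar` into a test, controlled by the minimising property, and an error of
  -- `pbar` alone. Each costs `|p* - pbar|_h + Z`.
  have hmain : weight μ h (C phat pbar) * |mass (phat - pbar) (C phat pbar)|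
      = tTest h C τ s phat pbar - τ phat pbar * weight μ h (C phat pbar) *
        (mass pbar (C phat pbar) - (1 / (n : ℝ)) * count s (C phat pbar)) := by
    rw [← (hτ phat pbar).2, tTest_eq hn, mass_sub]
    ring
  have hlast := (neg_le_abs _).trans (hbound phat pbar pbar (C phat pbar))
  have hfirst := one_sub_eps_mul_hNorm_le (𝒞 := 𝒞) (h := h) (C := C) hphat hpbar
  rw [hNorm_sub_comm 𝒞 h phat pbar, hmain] at hfirst
  linarith

theorem supNorm_sub_le (f g k : Space μ) : supNorm (f - k) ≤ supNorm (f - g) + supNorm (g - k) := by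
  have := supNorm_add_le (f - g) (g - k)
  rwa [sub_add_sub_cancel] at this

/-- From the semi-norm to the essential supremum norm. -/
theorem one_sub_eps_mul_kappa_mul_supNorm_le {phat pstar : Space μ} (hphat : phat ∈ m) {r : ℝ}
    (hr : ∀ pbar ∈ m, (1 - eps 𝒞 m h C) * hNorm 𝒞 h (pbar - phat)
      ≤ 2 * hNorm 𝒞 h (pstar - pbar) + r) :
    (1 - eps 𝒞 m h C) * kappa 𝒞 m h * supNorm (phat - pstar)
      ≤ (2 + (1 - eps 𝒞 m h C) * kappa 𝒞 m h) * (⨅ q : m, supNorm ((q : Space μ) - pstar))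
        + r := by
  have he := one_sub_eps_nonneg (𝒞 := 𝒞) (m := m) (h := h) (C := C)
  have hk := kappa_nonneg (𝒞 := 𝒞) (m := m) (h := h)
  have : Nonempty m := ⟨⟨phat, hphat⟩⟩
  rw [Real.mul_iInf_of_nonneg (add_nonneg zero_le_two (mul_nonneg he hk)), ← sub_le_iff_le_add]
  -- The triangle inequality passes through `q`: `κ` turns `‖q - phat‖_∞` into `|q - phat|_h`, and
  -- `|p* - q|_h ≤ ‖p* - q‖_∞` returns to the uniform norm.
  refine le_ciInf fun q => ?_
  have h1 := hr q q.2
  have h2 := kappa_mul_supNorm_le (𝒞 := 𝒞) (h := h) q.2 hphat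
  have h3 := supNorm_sub_le phat q pstar
  rw [supNorm_sub_comm phat q] at h3
  have h4 := hNorm_le_supNorm 𝒞 h (pstar - (q : Space μ))
  rw [supNorm_sub_comm pstar q] at h4
  have h5 := mul_le_mul_of_nonneg_left h3 (mul_nonneg he hk)
  have h6 := mul_le_mul_of_nonneg_left h2 he
  nlinarith

/-- Whichever of `D` and `2 √(S D)` is larger absorbs the other, with constants 44 and 22. -/
theorem two_mul_le_remainder (S D : ℝ) :
    2 * (6 * √(S * D) + 8 * D) ≤ max (58 * √(S * D)) (40 * D) := by
  have := Real.sqrt_nonneg (S * D)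
  rcases le_or_gt D (2 * √(S * D)) with h | h
  · exact le_max_of_le_left (by linarith)
  · exact le_max_of_le_right (by linarith)

/-- The deviation bound, rescaled by the weights. -/
theorem weight_mul_deviation_le {n : ℕ} (hn : n ≠ 0) (hh : 0 < h) {pstar : Space μ} {A : 𝒞}
    (hA : 0 ≤ mass pstar A) {G F : ℝ} (hG : 0 ≤ G)
    (hF : |n * mass pstar A - F| ≤ 6 * √(G * (n * mass pstar A)) + 8 * G) :
    weight μ h A * |mass pstar A - (1 / (n : ℝ)) * F|
      ≤ 6 * √(hNorm 𝒞 h pstar * (G / (h * n))) + 8 * (G / (h * n)) := by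
  have hn' : (0 : ℝ) < n := Nat.cast_pos.2 (Nat.pos_of_ne_zero hn)
  have hw := weight_nonneg (μ := μ) h (A : Set E)
  have hwh := weight_le (μ := μ) hh (A : Set E)
  have hS := le_hNorm hh pstar A
  rw [abs_of_nonneg hA] at hS
  have h1 : weight μ h A * |mass pstar A - (1 / (n : ℝ)) * F|
      = weight μ h A / n * |n * mass pstar A - F| := by
    rw [show mass pstar A - (1 / (n : ℝ)) * F = (1 / (n : ℝ)) * (n * mass pstar A - F) by
      field_simp, abs_mul, abs_of_pos (by positivity : (0 : ℝ) < 1 / n)]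
    ring
  have hD : weight μ h A / n * G ≤ G / (h * n) := by
    calc weight μ h A / n * G ≤ 1 / h / n * G := by gcongr
      _ = G / (h * n) := by field_simp
  -- Of the two weights brought under the root, one joins the mass to form at most `|p*|_h` and the
  -- other is at most `1 / h`.
  have hsq : weight μ h A / n * √(G * (n * mass pstar A))
      ≤ √(hNorm 𝒞 h pstar * (G / (h * n))) := by
    refine Real.le_sqrt_of_sq_le ?_
    rw [mul_pow, Real.sq_sqrt (by positivity)]
    calc (weight μ h A / n) ^ 2 * (G * (n * mass pstar A))
        = (weight μ h A * mass pstar A) * (weight μ h A / n * G) := by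
          field_simp
      _ ≤ hNorm 𝒞 h pstar * (G / (h * n)) :=
          mul_le_mul hS hD (by positivity) (hNorm_nonneg _ _ _)
  rw [h1]
  have h2 := mul_le_mul_of_nonneg_left hF (div_nonneg hw hn'.le)
  nlinarith

end Space

end Hun

/-! ### Assembly of the event and the risk bounds -/

theorem theorem1 {E : Type*} [MeasurableSpace E] (μ : Measure E) [SigmaFinite μ]
    (𝒞 : Set (Set E)) (h𝒞 : ∀ A ∈ 𝒞, MeasurableSet A) (hpm : Hun.PointwiseMeasurable 𝒞)
    (V : ℕ) (hV : Hun.vcDim 𝒞 = (V : ℕ∞))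
    (n : ℕ) (hn : 2 ≤ n)
    {Ω : Type*} [MeasurableSpace Ω] (P : Measure Ω) [IsProbabilityMeasure P]
    (X : Fin n → Ω → E) (hX : ∀ i, Measurable (X i)) (hind : iIndepFun X P)
    (p : Fin n → Hun.Space μ) (hp : ∀ i, Hun.IsDensity P (X i) (p i))
    (x : ℝ) (hx : 0 < x) :
    ∃ A : Set Ω, MeasurableSet A ∧ 1 - 2 * Real.exp (-x) ≤ P.real A ∧
      ∀ m : Set (Hun.Space μ), m.Countable →
      ∀ h : ℝ, 0 < h →
      ∀ (C : Hun.Space μ → Hun.Space μ → 𝒞) (τ : Hun.Space μ → Hun.Space μ → ℝ),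
        Hun.IsSign C τ →
      ∀ δ : ℝ, 0 < δ →
      ∀ phat : Ω → Hun.Space μ, Hun.IsHunEstimator X m h C τ δ phat →
      ∀ ω ∈ A,
        (∀ pbar ∈ m,
          (1 - Hun.eps 𝒞 m h C) * Hun.hNorm 𝒞 h (pbar - phat ω)
            ≤ 2 * Hun.hNorm 𝒞 h (Hun.mixture p - pbar) + δ
              + Hun.remainder 𝒞 n V x h (Hun.mixture p)) ∧
        (1 - Hun.eps 𝒞 m h C) * Hun.kappa 𝒞 m h * Hun.supNorm (phat ω - Hun.mixture p)
          ≤ (2 + (1 - Hun.eps 𝒞 m h C) * Hun.kappa 𝒞 m h)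
                * (⨅ q : m, Hun.supNorm ((q : Hun.Space μ) - Hun.mixture p))
              + δ + Hun.remainder 𝒞 n V x h (Hun.mixture p) := by
  obtain ⟨A, hA, hPA, hdev⟩ :=
    Hun.exists_event_deviation_le h𝒞 hpm hV hn P X hX hind hx.le
  refine ⟨A, hA, hPA, fun m _ h hh C τ hτ δ _ phat hphat ω hω => ?_⟩
  have hn0 : n ≠ 0 := by omega
  have hn' : (n : ℝ) ≠ 0 := Nat.cast_ne_zero.2 hn0
  have hG : 0 ≤ Hun.Gam n V + x := by linarith [Hun.quarter_le_Gam (V := V) hn]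
  have hZ : ∀ B : 𝒞, Hun.weight μ h B * |Hun.mass (Hun.mixture p) B
      - (1 / (n : ℝ)) * Hun.count (fun i => X i ω) B|
      ≤ 6 * √(Hun.hNorm 𝒞 h (Hun.mixture p) * ((Hun.Gam n V + x) / (h * n)))
        + 8 * ((Hun.Gam n V + x) / (h * n)) := by
    intro B
    have hmass := Hun.mass_mixture hp (h𝒞 B B.2)
    have hM : (n : ℝ) * Hun.mass (Hun.mixture p) B
        = Hun.meanCount (fun i => P.map (X i)) B := by
      rw [hmass]; field_simp
    refine Hun.weight_mul_deviation_le hn0 hh ?_ hG ?_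
    · rw [hmass]
      exact mul_nonneg (by positivity) (Hun.meanCount_nonneg _ _)
    · rw [hM]
      exact hdev ω hω B B.2
  have hrem := Hun.two_mul_le_remainder (Hun.hNorm 𝒞 h (Hun.mixture p))
    ((Hun.Gam n V + x) / (h * n))
  rw [← mul_div_assoc] at hrem
  have hfirst : ∀ pbar ∈ m, (1 - Hun.eps 𝒞 m h C) * Hun.hNorm 𝒞 h (pbar - phat ω)
      ≤ 2 * Hun.hNorm 𝒞 h (Hun.mixture p - pbar)
        + (δ + Hun.remainder 𝒞 n V x h (Hun.mixture p)) := by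
    intro pbar hpbar
    have := Hun.one_sub_eps_mul_hNorm_le_of_deviation hn0 hh hτ hZ (hphat ω).1 hpbar
      ((hphat ω).2 pbar hpbar)
    rw [← mul_div_assoc] at this
    unfold Hun.remainder
    linarith
  refine ⟨fun pbar hpbar => by linarith [hfirst pbar hpbar], ?_⟩
  have := Hun.one_sub_eps_mul_kappa_mul_supNorm_le (hphat ω).1 hfirst
  linarith
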